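/- Let $d\ge 1$, $N\ge 1$, $r>0$ and $1\le p<\infty$. For points $x_1,\dots,x_N\in[0,1]^d$ and $x\in[0,1]^d$ put $[0,x[\,=\prod_{k=1}^d[0,x_k[$ and $$\delta(x)=\frac{\#\{i: x_i\in[0,x[\,\}}{N}-\big|[0,x[\big|,$$ where $|\cdot|$ is Lebesgue measure on $\mathbb R^d$, and define the $\mathcal L_p$-discrepancy and the star discrepancy by $$\mathcal L_p(x_1,\dots,x_N)=\Big(\int_{[0,1]^d}|\delta(x)|^p\,dx\Big)^{1/p},\qquad D^*(x_1,\dots,x_N)=\sup_{x\in[0,1]^d}|\delta(x)|.$$ A partition of $[0,1]^d$ into $N$ sets is a tuple $\mathbf\Omega=(\Omega_1,\dots,\Omega_N)$ of Lebesgue measurable sets with union $[0,1]^d$ and $|\Omega_i\cap\Omega_j|=0$ for $i\ne j$; it is equivolume if $|\Omega_1|=\dots=|\Omega_N|$. Its stratified sample $\mathcal P_{\mathbf\Omega}=(X_1,\dots,X_N)$ consists of independent random points, $X_i$ being uniformly distributed in $\Omega_i$. A set $A\subset\mathbb R^d$ has reach at least $r$ if every point of $\mathbb R^d$ with Euclidean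 distance less than $r$ from $A$ has a unique closest point in $A$. Let $\mathfrak P_N(r)$ be the class of equivolume partitions of $[0,1]^d$ into $N$ non-empty compact sets with reach at least $r$, and $\mathfrak P_N^{\mathrm{conv}}$ the class of equivolume partitions of $[0,1]^d$ into $N$ non-empty compact convex sets. For every equivolume partition $\mathbf\Omega$ of $[0,1]^d$ into $N$ sets the random variables $\mathcal L_p(\mathcal P_{\mathbf\Omega})^p$ and $D^*(\mathcal P_{\mathbf\Omega})$ are integrable, and there are partitions $\mathbf\Omega^p,\mathbf\Omega^*\in\mathfrak P_N(r)$ such that $$\mathbb E\,\mathcal L_p(\mathcal P_{\mathbf\Omega^p})^p=\min_{\mathbf\Omega\in\mathfrak P_N(r)}\mathbb E\,\mathcal L_p(\mathcal P_{\mathbf\Omega})^p,\qquad \mathbb E\,D^*(\mathcal P_{\mathbf\Omega^*})=\min_{\mathbf\Omega\in\mathfrak P_N(r)}\mathbb E\,D^*(\mathcal P_{\mathbf\Omega}).$$ Likewise, there are partitions in $\mathfrak P_N^{\mathrm{conv}}$ that minimize $\mathbb E\,\mathcal L_p(\mathcal P_{\mathbf\Omega})^p$ and $\mathbb E\,D^*(\mathcal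 P_{\mathbf\Omega})$, respectively, over $\mathfrak P_N^{\mathrm{conv}}$. -/

import Mathlib

open MeasureTheory

noncomputable section

namespace Stratified

/-- `ℝ^d` with the Euclidean norm and Lebesgue measure. -/
abbrev E (d : ℕ) : Type := EuclideanSpace ℝ (Fin d)

/-- The unit cube `[0,1]^d`. -/
def unitCube (d : ℕ) : Set (E d) := {x | ∀ k, 0 ≤ x k ∧ x k ≤ 1}

/-- The half-open box `[0,x[ = ∏ₖ [0, xₖ[`. -/
def box {d : ℕ} (x : E d) : Set (E d) := {y | ∀ k, 0 ≤ y k ∧ y k < x k}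

/-- The number of indices `i` such that the `i`-th point lies in `[0,x[`. -/
def countBox {d N : ℕ} (P : Fin N → E d) (x : E d) : ℕ := Set.ncard {i | P i ∈ box x}

/-- The discrepancy function `#(P ∩ [0,x[)/N - |[0,x[|`. -/
def discFun {d N : ℕ} (P : Fin N → E d) (x : E d) : ℝ :=
  (countBox P x : ℝ) / (N : ℝ) - volume.real (box x)

/-- The `L_p`-discrepancy of an `N`-tuple of points. -/
def lpDisc {d N : ℕ} (p : ℝ) (P : Fin N → E d) : ℝ :=
  (∫ x in unitCube d, |discFun P x| ^ p) ^ (1 / p)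

/-- The star discrepancy of an `N`-tuple of points. -/
def starDisc {d N : ℕ} (P : Fin N → E d) : ℝ :=
  ⨆ x : unitCube d, |discFun P (x : E d)|

/-- Partitions of the unit cube into `N` Lebesgue measurable sets, which may overlap in
Lebesgue null sets. -/
structure IsPartition {d N : ℕ} (Ω : Fin N → Set (E d)) : Prop where
  measurable : ∀ i, NullMeasurableSet (Ω i) volume
  cover : (⋃ i, Ω i) = unitCube d
  overlap : ∀ i j, i ≠ j → volume (Ω i ∩ Ω j) = 0

/-- All sets of the partition have the same volume. -/
def IsEquivolume {d N : ℕ} (Ω : Fin N → Set (E d)) : Prop :=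
  ∀ i j, volume (Ω i) = volume (Ω j)

/-- The set `A` has reach at least `r`: every point with distance less than `r` from `A` has a
unique closest point in `A`. -/
def ReachAtLeast {d : ℕ} (r : ℝ) (A : Set (E d)) : Prop :=
  ∀ x, Metric.infDist x A < r → ∃ y ∈ A, ∀ z ∈ A, z ≠ y → ‖x - y‖ < ‖x - z‖

/-- `𝔓_N(r)`: equivolume partitions of `[0,1]^d` into `N` non-empty compact sets with reach at
least `r`. -/
def reachPartitions (d N : ℕ) (r : ℝ) : Set (Fin N → Set (E d)) :=
  {Ω | IsPartition Ω ∧ IsEquivolume Ω ∧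
    ∀ i, (Ω i).Nonempty ∧ IsCompact (Ω i) ∧ ReachAtLeast r (Ω i)}

/-- `𝔓_N^conv`: equivolume partitions of `[0,1]^d` into `N` non-empty compact convex sets. -/
def convexPartitions (d N : ℕ) : Set (Fin N → Set (E d)) :=
  {Ω | IsPartition Ω ∧ IsEquivolume Ω ∧
    ∀ i, (Ω i).Nonempty ∧ IsCompact (Ω i) ∧ Convex ℝ (Ω i)}

/-- The law of the stratified sample `(X₁, …, X_N)`: the points are independent and `Xᵢ` is
uniform in `Ωᵢ`, that is, distributed as normalized Lebesgue measure on `Ωᵢ`. -/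
def sampleLaw {d N : ℕ} (Ω : Fin N → Set (E d)) : Measure (Fin N → E d) :=
  Measure.pi fun i => ProbabilityTheory.cond volume (Ω i)

/-- The mean `L_p`-discrepancy `𝔼 L_p(P_Ω)^p` of the stratified sample. -/
def meanLp {d N : ℕ} (p : ℝ) (Ω : Fin N → Set (E d)) : ℝ :=
  ∫ P, lpDisc p P ^ p ∂(sampleLaw Ω)

/-- The mean star discrepancy `𝔼 D^*(P_Ω)` of the stratified sample. -/
def meanStar {d N : ℕ} (Ω : Fin N → Set (E d)) : ℝ :=
  ∫ P, starDisc P ∂(sampleLaw Ω)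

end Stratified

end

noncomputable section

namespace Stratified

open Metric Filter Topology TopologicalSpace

/-! The proof is the direct method. For every equivolume partition the law of the sample is `N ^ N`
times Lebesgue measure on the product of the pieces, so a mean discrepancy is the integral of a
fixed bounded measurable function over a varying domain. It is continuous in the partition as soon
as the indicators of the pieces converge almost everywhere; no continuity of the discrepancy is
needed. Compactness comes from Blaschke selection in the Hausdorff metric.

Hausdorff convergence alone does not control volumes; the lower bound on the reach does. Reach at
least `r` is recast as `Escapable`, an inequality between distance functions that survives Hausdorff
limits, so the class is closed. If a point `x` of the limit set `L` is missed by infinitely many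
sets of the sequence, the escape property passes to the limit at `x` and yields a ball disjoint from
`L` whose closure contains `x`. Then `x` is not a density point of `L`, and by Lebesgue's theorem
such points form a null set (`ae_eventually_mem_iff_of_tendsto`).

Convex sets have every reach and are also closed under Hausdorff limits, so the same argument serves
both classes. -/

variable {d N : ℕ}

/-! ### Reach, convexity and Hausdorff limits -/

/-- Every point `x` outside `A` with `infDist x A + s < r` can be moved by at most `s` so that its
distance to `A` grows by `s`. For closed sets this is equivalent to having reach at least `r`,
and it is evidently stable under Hausdorff limits. -/
def Escapable (r : ℝ) (A : Set (E d)) : Prop :=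
  ∀ x s, 0 < infDist x A → 0 ≤ s → infDist x A + s < r →
    ∃ y, dist y x ≤ s ∧ infDist x A + s ≤ infDist y A

/-- If `x ∉ A` has a unique closest point in `A`, then the distance to `A` grows with unit speed
in the direction away from this point. -/
theorem exists_unit_speed_direction {A : Set (E d)} (hA : IsClosed A) {x y : E d}
    (hx : 0 < infDist x A) (hy : y ∈ A) (huniq : ∀ z ∈ A, z ≠ y → ‖x - y‖ < ‖x - z‖)
    {ε : ℝ} (hε : 0 < ε) (hε1 : ε < 1) :
    ∃ v : E d, ‖v‖ = 1 ∧ ∃ h₀ > 0, ∀ h, 0 < h → h < h₀ →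
      infDist x A + (1 - ε) * h ≤ infDist (x + h • v) A := by
  have hne : A.Nonempty := ⟨y, hy⟩
  set D := infDist x A with hD
  have hDy : ‖x - y‖ = D := by
    obtain ⟨q, hq, hqd⟩ := hA.exists_infDist_eq_dist hne x
    by_cases hqy : q = y
    · rw [hD, hqd, hqy, dist_eq_norm]
    · have h1 := huniq q hq hqy
      have h2 : D ≤ dist x y := infDist_le_dist_of_mem hy
      rw [dist_eq_norm] at hqd h2
      linarith
  set v : E d := D⁻¹ • (x - y) with hv
  have hv1 : ‖v‖ = 1 := by
    rw [hv, norm_smul, hDy, Real.norm_eq_abs, abs_of_pos (inv_pos.2 hx), inv_mul_cancel₀ hx.ne']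
  have hvy : inner ℝ v (x - y) = D := by
    rw [hv, real_inner_smul_left, real_inner_self_eq_norm_sq, hDy]
    field_simp
  -- points of `A` in a bad direction are uniformly further away
  obtain ⟨m, hm, hmS⟩ : ∃ m > D, ∀ z ∈ A, inner ℝ v (x - z) ≤ (1 - ε) * D → m ≤ dist x z := by
    set S : Set (E d) := A ∩ {z | inner ℝ v (x - z) ≤ (1 - ε) * D} with hS
    have hSc : IsClosed S := hA.inter (isClosed_le (by fun_prop) (by fun_prop))
    rcases S.eq_empty_or_nonempty with h0 | hSne
    · refine ⟨D + 1, by linarith, fun z hz hz' => ?_⟩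
      have : z ∈ S := ⟨hz, hz'⟩
      simp [h0] at this
    · refine ⟨infDist x S, ?_, fun z hz hz' => infDist_le_dist_of_mem ⟨hz, hz'⟩⟩
      obtain ⟨q, hq, hqd⟩ := hSc.exists_infDist_eq_dist hSne x
      have hqy : q ≠ y := by
        rintro rfl
        have := hq.2
        simp only [Set.mem_ofPred_eq, hvy] at this
        nlinarith
      have := huniq q hq.1 hqy
      rw [hqd, dist_eq_norm]
      linarith
  -- A point of `A` closest to `x + h • v` is within `D + 2 * h` of `x`; this bound keeps that below
  -- `m`, hence the point out of the bad directions.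
  refine ⟨v, hv1, (m - D) / 2, by linarith, fun h h0 hlt => ?_⟩
  obtain ⟨q, hq, hqd⟩ := hA.exists_infDist_eq_dist hne (x + h • v)
  have hmove : dist (x + h • v) x = h := by
    rw [dist_eq_norm, add_sub_cancel_left, norm_smul, hv1, Real.norm_eq_abs, abs_of_pos h0, mul_one]
  have hqx : dist x q < m := by
    have h1 : dist x q ≤ dist x (x + h • v) + dist (x + h • v) q := dist_triangle _ _ _
    have h2 : infDist (x + h • v) A ≤ infDist x A + dist (x + h • v) x :=
      infDist_le_infDist_add_dist
    rw [dist_comm x (x + h • v), hmove, ← hqd] at h1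
    rw [hmove] at h2
    linarith
  have hin : (1 - ε) * D < inner ℝ v (x - q) := by
    by_contra hcon
    exact absurd (hmS q hq (not_lt.1 hcon)) (not_le.2 hqx)
  have hDq : D ≤ ‖x - q‖ := by
    rw [← dist_eq_norm]; exact infDist_le_dist_of_mem hq
  have hsq : ‖x + h • v - q‖ ^ 2 = ‖x - q‖ ^ 2 + 2 * h * inner ℝ v (x - q) + h ^ 2 := by
    have : x + h • v - q = (x - q) + h • v := by abel
    rw [this, norm_add_sq_real, real_inner_smul_right, norm_smul, hv1, real_inner_comm,
      Real.norm_eq_abs, abs_of_pos h0]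
    ring
  rw [hqd, dist_eq_norm]
  -- It remains to compare `D ^ 2 + 2 * h * ((1 - ε) * D) + h ^ 2` with `(D + (1 - ε) * h) ^ 2`.
  refine le_of_sq_le_sq ?_ (norm_nonneg _)
  rw [hsq]
  have h3 : D ^ 2 ≤ ‖x - q‖ ^ 2 := by gcongr
  have h4 : 2 * h * ((1 - ε) * D) ≤ 2 * h * inner ℝ v (x - q) := by gcongr
  have h5 : (1 - ε) ^ 2 * h ^ 2 ≤ 1 * h ^ 2 := by
    gcongr
    nlinarith
  nlinarith

/-- Maximize `infDist z A - (1 - ε) * dist z x` over the ball of radius `s` about `x`. A maximizer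
inside the open ball still has distance less than `r` from `A`, hence a unique closest point, and
moving away from it at rate `1 - ε / 2` would increase the function. So the maximizer lies on the
sphere and gains at least `(1 - ε) * s`. Then `ε` tends to `0`. -/
theorem ReachAtLeast.escapable {r : ℝ} {A : Set (E d)} (hA : IsClosed A)
    (h : ReachAtLeast r A) : Escapable r A := by
  intro x s hx hs hr
  have hcpt : IsCompact (closedBall x s) := isCompact_closedBall x s
  have hne : (closedBall x s).Nonempty := nonempty_closedBall.2 hs
  obtain ⟨y, hy, hymax⟩ := hcpt.exists_isMaxOn hne (continuous_infDist_pt A).continuousOn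
  refine ⟨y, hy, le_of_forall_pos_lt_add fun η hη => ?_⟩
  rcases hs.eq_or_lt with rfl | hspos
  · have := hymax (mem_closedBall_self le_rfl)
    simp only [Set.mem_ofPred_eq] at this
    linarith
  obtain ⟨ε, hε, hε1, hεη⟩ : ∃ ε > 0, ε < 1 ∧ ε * s < η := by
    refine ⟨min (1 / 2) (η / (2 * s)), by positivity, by
      have := min_le_left (1 / 2 : ℝ) (η / (2 * s)); linarith, ?_⟩
    have h1 : min (1 / 2) (η / (2 * s)) * s ≤ η / (2 * s) * s := by gcongr; exact min_le_right _ _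
    have h2 : η / (2 * s) * s = η / 2 := by field_simp
    linarith
  obtain ⟨w, hw, hwmax⟩ := hcpt.exists_isMaxOn hne
    (f := fun z => infDist z A - (1 - ε) * dist z x)
    (by fun_prop)
  have hwx := hwmax (mem_closedBall_self hs)
  simp only [Set.mem_ofPred_eq, dist_self, mul_zero, sub_zero] at hwx
  have hwy := hymax hw
  simp only [Set.mem_ofPred_eq] at hwy
  have hw' : dist w x ≤ s := hw
  have hwpos : 0 < infDist w A := by
    have : 0 ≤ (1 - ε) * dist w x := mul_nonneg (by linarith) dist_nonneg
    linarith
  rcases hw'.eq_or_lt with heq | hlt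
  · rw [heq] at hwx
    nlinarith
  · exfalso
    have hwr : infDist w A < r := by
      have := infDist_le_infDist_add_dist (s := A) (x := w) (y := x)
      linarith
    obtain ⟨q, hq, hquniq⟩ := h w hwr
    obtain ⟨v, hv, h₀, hh₀, hgrow⟩ := exists_unit_speed_direction hA hwpos hq hquniq
      (half_pos hε) (by linarith)
    obtain ⟨t, ht0, htlt⟩ := exists_between (lt_min hh₀ (sub_pos.2 hlt))
    have ht1 := htlt.trans_le (min_le_left _ _)
    have ht2 := htlt.trans_le (min_le_right _ _)
    have hg := hgrow t ht0 ht1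
    have hd : dist (w + t • v) x ≤ dist w x + t := by
      have h1 := dist_triangle (w + t • v) w x
      have h2 : dist (w + t • v) w = t := by
        rw [dist_eq_norm, add_sub_cancel_left, norm_smul, hv, Real.norm_eq_abs, abs_of_pos ht0,
          mul_one]
      linarith
    have hmem : w + t • v ∈ closedBall x s := by
      rw [mem_closedBall]; linarith
    have hmax := hwmax hmem
    simp only [Set.mem_ofPred_eq] at hmax
    have h3 : (1 - ε) * dist (w + t • v) x ≤ (1 - ε) * (dist w x + t) :=
      mul_le_mul_of_nonneg_left hd (by linarith)
    nlinarith

/-- With `t = infDist x A` and an escape point `w`, every closest point `q` satisfies `t + s ≤ dist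
w q ≤ dist w x + dist x q ≤ s + t`. Equality in the triangle inequality puts `q` on the ray from `w`
through `x`, at distance `t` from `x`, which determines it. -/
theorem Escapable.reachAtLeast {r : ℝ} {A : Set (E d)} (hA : IsClosed A)
    (hne : A.Nonempty) (h : Escapable r A) : ReachAtLeast r A := by
  intro x hxr
  obtain ⟨y, hy, hyd⟩ := hA.exists_infDist_eq_dist hne x
  refine ⟨y, hy, fun z hz hzy => ?_⟩
  rw [← dist_eq_norm, ← dist_eq_norm, ← hyd]
  refine lt_of_le_of_ne (infDist_le_dist_of_mem hz) fun hzd => hzy ?_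
  rcases infDist_nonneg (x := x) (s := A) |>.eq_or_lt with h0 | hpos
  · have h1 : x = y := dist_eq_zero.1 (by rw [← hyd, ← h0])
    have h2 : x = z := dist_eq_zero.1 (by rw [← hzd, ← h0])
    rw [← h1, ← h2]
  · set t := infDist x A
    obtain ⟨s, hs, hsr⟩ : ∃ s > 0, t + s < r := ⟨(r - t) / 2, by linarith, by linarith⟩
    obtain ⟨w, hw, hwd⟩ := h x s hpos hs.le hsr
    -- a closest point lies on the ray from `w` through `x`
    have key : ∀ q ∈ A, dist x q = t → x - w = (s / t) • (q - x) := by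
      intro q hq hqt
      have h1 : t + s ≤ dist w q := hwd.trans (infDist_le_dist_of_mem hq)
      have h2 := dist_triangle w x q
      have hwx : dist w x = s := by linarith
      have heq : ‖(x - w) + (q - x)‖ = ‖x - w‖ + ‖q - x‖ := by
        have e1 : (x - w) + (q - x) = q - w := by abel
        rw [e1, ← dist_eq_norm, ← dist_eq_norm, ← dist_eq_norm, dist_comm q w, dist_comm x w,
          dist_comm q x]
        linarith
      have hray := sameRay_iff_norm_add.2 heq
      have := hray.norm_smul_eq
      rw [← dist_eq_norm, ← dist_eq_norm, dist_comm x w, hwx, dist_comm q x, hqt] at this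
      rw [div_eq_inv_mul, mul_smul, this, smul_smul, inv_mul_cancel₀ hpos.ne', one_smul]
    have hyz : (s / t) • (z - x) = (s / t) • (y - x) :=
      (key z hz hzd.symm).symm.trans (key y hy hyd.symm)
    have := smul_right_injective (E d) (div_pos hs hpos).ne' hyz
    exact sub_left_injective this

/-- The midpoint of two distinct closest points would be strictly closer, since balls are strictly
convex. -/
theorem reachAtLeast_of_convex {A : Set (E d)} (hA : IsClosed A) (hne : A.Nonempty)
    (hconv : Convex ℝ A) (r : ℝ) : ReachAtLeast r A := by
  intro x _
  obtain ⟨y, hy, hyd⟩ := hA.exists_infDist_eq_dist hne x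
  refine ⟨y, hy, fun z hz hzy => ?_⟩
  rw [← dist_eq_norm, ← dist_eq_norm, ← hyd]
  refine lt_of_le_of_ne (infDist_le_dist_of_mem hz) fun hzd => ?_
  have hmid : midpoint ℝ y z ∈ A := hconv.midpoint_mem hy hz
  have hlt : dist (midpoint ℝ y z) x < infDist x A := by
    have := (strictConvex_closedBall ℝ x (infDist x A))
      (x := y) (by rw [mem_closedBall, dist_comm, hyd]) (y := z)
      (by rw [mem_closedBall, dist_comm, hzd]) hzy.symm
      (a := 1 / 2) (b := 1 / 2) (by norm_num) (by norm_num) (by norm_num)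
    have hpos : infDist x A ≠ 0 := by
      intro h0
      exact hzy ((dist_eq_zero.1 (hzd.symm.trans h0)).symm.trans
        (dist_eq_zero.1 (hyd.symm.trans h0)))
    rw [interior_closedBall _ hpos, mem_ball] at this
    rw [midpoint_eq_smul_add, smul_add]
    simpa using this
  have := infDist_le_dist_of_mem (x := x) hmid
  rw [dist_comm] at this
  linarith

theorem tendsto_infDist_nonemptyCompacts {α ι : Type*} [MetricSpace α] {l : Filter ι}
    {K : ι → NonemptyCompacts α} {L : NonemptyCompacts α} (hK : Tendsto K l (𝓝 L))
    {u : ι → α} {x : α} (hu : Tendsto u l (𝓝 x)) :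
    Tendsto (fun n => infDist (u n) (K n)) l (𝓝 (infDist x L)) := by
  have hu' := tendsto_iff_dist_tendsto_zero.1 hu
  have hK' := tendsto_iff_dist_tendsto_zero.1 hK
  refine tendsto_iff_dist_tendsto_zero.2 (squeeze_zero (fun _ => dist_nonneg) (fun n => ?_)
    (by simpa using hu'.add hK'))
  refine (dist_triangle _ (infDist x (K n)) _).trans (add_le_add ?_ ?_)
  · simpa using (lipschitz_infDist_pt (K n : Set α)).dist_le_mul (u n) x
  · simpa using (lipschitz_infDist_set x).dist_le_mul (K n) L

/-- The escape points lie in a fixed ball, so a subsequence converges. Positive distance is required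
only from infinitely many `K n`, not from `L`: the case `x ∈ L` is the one that controls volumes. -/
theorem exists_escape_of_tendsto {r : ℝ} {K : ℕ → NonemptyCompacts (E d)}
    {L : NonemptyCompacts (E d)} (hK : Tendsto K atTop (𝓝 L))
    (hesc : ∀ n, Escapable r (K n : Set (E d))) {x : E d} {s : ℝ} (hs : 0 ≤ s) (hr : infDist x L + s < r)
    (hx : ∃ᶠ n in atTop, 0 < infDist x (K n)) :
    ∃ y, dist y x ≤ s ∧ infDist x L + s ≤ infDist y L := by
  have hev : ∀ᶠ n in atTop, infDist x (K n) + s < r :=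
    ((tendsto_infDist_nonemptyCompacts hK tendsto_const_nhds).add_const s).eventually_lt_const hr
  obtain ⟨φ, hφ, hφ'⟩ := extraction_of_frequently_atTop (hx.and_eventually hev)
  choose y hy hyd using fun n => hesc (φ n) x s (hφ' n).1 hs (hφ' n).2
  obtain ⟨z, hz, ψ, hψ, hlim⟩ := (isCompact_closedBall x s).tendsto_subseq
    (fun n => mem_closedBall.2 (hy n))
  have hKs : Tendsto (fun n => K (φ (ψ n))) atTop (𝓝 L) :=
    hK.comp (hφ.comp hψ).tendsto_atTop
  exact ⟨z, hz, le_of_tendsto_of_tendsto'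
    ((tendsto_infDist_nonemptyCompacts hKs tendsto_const_nhds).add_const s)
    (tendsto_infDist_nonemptyCompacts hKs hlim) fun n => hyd (ψ n)⟩

theorem Escapable.of_tendsto {r : ℝ} {K : ℕ → NonemptyCompacts (E d)}
    {L : NonemptyCompacts (E d)} (hK : Tendsto K atTop (𝓝 L))
    (hesc : ∀ n, Escapable r (K n : Set (E d))) : Escapable r (L : Set (E d)) :=
  fun _ _ hx hs hr => exists_escape_of_tendsto hK hesc hs hr
    ((tendsto_infDist_nonemptyCompacts hK tendsto_const_nhds).eventually_const_lt hx).frequently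

theorem ReachAtLeast.of_tendsto {r : ℝ} {K : ℕ → NonemptyCompacts (E d)}
    {L : NonemptyCompacts (E d)} (hK : Tendsto K atTop (𝓝 L))
    (hreach : ∀ n, ReachAtLeast r (K n : Set (E d))) : ReachAtLeast r (L : Set (E d)) :=
  (Escapable.of_tendsto hK fun n => (hreach n).escapable (K n).isCompact.isClosed).reachAtLeast
    L.isCompact.isClosed L.nonempty

theorem mem_iff_infDist_eq_zero (K : NonemptyCompacts (E d)) (x : E d) :
    x ∈ (K : Set (E d)) ↔ infDist x K = 0 :=
  K.isCompact.isClosed.mem_iff_infDist_zero K.nonempty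

theorem notMem_iff_infDist_pos (K : NonemptyCompacts (E d)) (x : E d) :
    x ∉ (K : Set (E d)) ↔ 0 < infDist x K :=
  K.isCompact.isClosed.notMem_iff_infDist_pos K.nonempty

theorem infDist_convexCombo_le {A : Set (E d)} (hA : IsClosed A) (hne : A.Nonempty)
    (hconv : Convex ℝ A) {x y : E d} {a b : ℝ} (ha : 0 ≤ a) (hb : 0 ≤ b) (hab : a + b = 1) :
    infDist (a • x + b • y) A ≤ a * infDist x A + b * infDist y A := by
  obtain ⟨p, hp, hpd⟩ := hA.exists_infDist_eq_dist hne x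
  obtain ⟨q, hq, hqd⟩ := hA.exists_infDist_eq_dist hne y
  refine (infDist_le_dist_of_mem (hconv hp hq ha hb hab)).trans ?_
  rw [hpd, hqd]
  refine (dist_add_add_le _ _ _ _).trans ?_
  rw [dist_smul₀, dist_smul₀, Real.norm_of_nonneg ha, Real.norm_of_nonneg hb]

theorem convex_of_tendsto {K : ℕ → NonemptyCompacts (E d)}
    {L : NonemptyCompacts (E d)} (hK : Tendsto K atTop (𝓝 L))
    (hconv : ∀ n, Convex ℝ (K n : Set (E d))) : Convex ℝ (L : Set (E d)) := by
  intro x hx y hy a b ha hb hab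
  rw [mem_iff_infDist_eq_zero] at hx hy ⊢
  refine le_antisymm ?_ infDist_nonneg
  have h := le_of_tendsto_of_tendsto' (tendsto_infDist_nonemptyCompacts hK tendsto_const_nhds)
    (((tendsto_infDist_nonemptyCompacts hK tendsto_const_nhds).const_mul a).add
      ((tendsto_infDist_nonemptyCompacts hK tendsto_const_nhds).const_mul b))
    fun n => infDist_convexCombo_le (K n).isCompact.isClosed (K n).nonempty (hconv n)
      (x := x) (y := y) ha hb hab
  simpa [hx, hy] using h

/-! ### Almost everywhere convergence of indicators -/

/-- A density point of `A` is not touched by a ball disjoint from `A`. -/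
theorem not_touching_of_density {A : Set (E d)} {x c : E d} {s : ℝ}
    (hs : 0 < s) (hc : dist c x ≤ s) (hcA : s ≤ infDist c A)
    (hx : Tendsto (fun ρ => volume (A ∩ closedBall x ρ) / volume (closedBall x ρ)) (𝓝[>] 0)
      (𝓝 1)) : False := by
  have hdisj : Disjoint A (ball c s) := by
    rw [Set.disjoint_left]
    intro z hz hzc
    have := infDist_le_dist_of_mem (x := c) hz
    rw [mem_ball, dist_comm] at hzc
    linarith
  have hbound : ∀ᶠ ρ in 𝓝[>] (0 : ℝ), volume (A ∩ closedBall x ρ) / volume (closedBall x ρ) ≤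
      1 - ENNReal.ofReal ((1 / 2) ^ d) := by
    filter_upwards [Ioo_mem_nhdsGT hs] with ρ hρ
    have hρ0 : 0 < ρ := hρ.1
    -- Shifting the centre from `x` towards `c` by this fraction puts the ball of radius `ρ / 2`
    -- inside both `closedBall x ρ` and `ball c s`, so `A` misses a share `(1 / 2) ^ d` of the
    -- volume at every small scale.
    set z : E d := x + (ρ / (2 * s)) • (c - x) with hz
    have hcoef : 0 ≤ ρ / (2 * s) := by positivity
    have hcoef' : ρ / (2 * s) * s = ρ / 2 := by field_simp
    have hzx : dist z x ≤ ρ / 2 := by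
      rw [hz, dist_eq_norm, add_sub_cancel_left, norm_smul, Real.norm_of_nonneg hcoef,
        ← dist_eq_norm, ← hcoef']
      gcongr
    have hzc : dist z c ≤ s - ρ / 2 := by
      have e : z - c = (1 - ρ / (2 * s)) • (x - c) := by
        rw [hz]; module
      have h1 : 0 ≤ 1 - ρ / (2 * s) := by
        rw [sub_nonneg, div_le_one (by positivity)]; linarith [hρ.2]
      rw [dist_eq_norm, e, norm_smul, Real.norm_of_nonneg h1, ← dist_eq_norm, dist_comm x c]
      calc (1 - ρ / (2 * s)) * dist c x ≤ (1 - ρ / (2 * s)) * s := by gcongr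
        _ = s - ρ / 2 := by rw [sub_mul, hcoef']; ring
    have hsub : A ∩ closedBall x ρ ⊆ closedBall x ρ \ ball z (ρ / 2) := by
      rintro w ⟨hwA, hw⟩
      refine ⟨hw, fun hwz => Set.disjoint_left.1 hdisj hwA ?_⟩
      rw [mem_ball] at hwz ⊢
      linarith [dist_triangle w z c]
    have hsub' : ball z (ρ / 2) ⊆ closedBall x ρ := by
      intro w hw
      rw [mem_ball] at hw
      rw [mem_closedBall]
      linarith [dist_triangle w z x]
    have hvol : volume (ball z (ρ / 2)) = ENNReal.ofReal ((1 / 2) ^ d) * volume (closedBall x ρ) := by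
      rw [Measure.addHaar_ball_of_pos _ _ (by positivity), Measure.addHaar_closedBall _ _ hρ0.le,
        ← mul_assoc, ← ENNReal.ofReal_mul (by positivity), finrank_euclideanSpace_fin, ← mul_pow]
      congr 3
      ring
    have hpos : volume (closedBall x ρ) ≠ 0 := (measure_closedBall_pos _ _ hρ0).ne'
    have hfin : volume (closedBall x ρ) ≠ ⊤ := measure_closedBall_lt_top.ne
    refine ENNReal.div_le_of_le_mul ?_
    rw [ENNReal.sub_mul (fun _ _ => hfin), one_mul, ← hvol]
    refine (measure_mono hsub).trans ?_
    rw [measure_sdiff hsub' measurableSet_ball.nullMeasurableSet measure_ball_lt_top.ne]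
  have hle := le_of_tendsto hx hbound
  have : (1 : ENNReal) - ENNReal.ofReal ((1 / 2) ^ d) < 1 :=
    ENNReal.sub_lt_self ENNReal.one_ne_top one_ne_zero
      (ENNReal.ofReal_pos.2 (by positivity)).ne'
  exact absurd hle (not_le.2 this)

/-- Hausdorff convergence of sets with reach bounded from below implies convergence almost
everywhere of their indicator functions. -/
theorem ae_eventually_mem_iff_of_tendsto {r : ℝ} (hr : 0 < r) {K : ℕ → NonemptyCompacts (E d)}
    {L : NonemptyCompacts (E d)} (hK : Tendsto K atTop (𝓝 L))
    (hreach : ∀ n, ReachAtLeast r (K n : Set (E d))) :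
    ∀ᵐ x : E d, ∀ᶠ n in atTop, (x ∈ (K n : Set (E d)) ↔ x ∈ (L : Set (E d))) := by
  have hmeas : MeasurableSet (L : Set (E d)) := L.isCompact.measurableSet
  have hdens := (ae_restrict_iff' hmeas).1
    (Besicovitch.ae_tendsto_measure_inter_div volume (L : Set (E d)))
  filter_upwards [hdens] with x hx
  by_cases hxL : x ∈ (L : Set (E d))
  · have h0 := (mem_iff_infDist_eq_zero L x).1 hxL
    suffices h : ∀ᶠ n in atTop, x ∈ (K n : Set (E d)) by
      filter_upwards [h] with n hn using iff_of_true hn hxL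
    by_contra hcon
    rw [not_eventually] at hcon
    -- Since `infDist x L = 0`, the ball of radius `r / 2` about `y` misses `L`, while `x` is within
    -- `r / 2` of `y`.
    obtain ⟨y, hy, hyd⟩ := exists_escape_of_tendsto hK
      (fun n => (hreach n).escapable (K n).isCompact.isClosed) (x := x) (s := r / 2)
      (by positivity) (by rw [h0]; linarith)
      (hcon.mono fun n hn => (notMem_iff_infDist_pos _ _).1 hn)
    exact not_touching_of_density (half_pos hr) hy (by linarith) (hx hxL)
  · filter_upwards [(tendsto_infDist_nonemptyCompacts hK tendsto_const_nhds).eventually_const_lt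
      ((notMem_iff_infDist_pos L x).1 hxL)] with n hn
    exact iff_of_false ((notMem_iff_infDist_pos _ _).2 hn) hxL

/-! ### The unit cube and the law of the stratified sample -/

theorem volume_setOf_Icc (a b : Fin d → ℝ) :
    volume {x : E d | ∀ k, a k ≤ x k ∧ x k ≤ b k} = ∏ k, ENNReal.ofReal (b k - a k) := by
  rw [← Real.volume_Icc_pi,
    ← (EuclideanSpace.volume_preserving_symm_measurableEquiv_toLp (Fin d)).measure_preimage_equiv]
  congr 1
  ext x
  simp [Pi.le_def, forall_and]

theorem volume_box (x : E d) : volume (box x) = ∏ k, ENNReal.ofReal (x k) := by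
  have h := Real.volume_pi_Ico (a := fun _ : Fin d => 0) (b := fun k => x k)
  simp only [sub_zero] at h
  rw [← h,
    ← (EuclideanSpace.volume_preserving_symm_measurableEquiv_toLp (Fin d)).measure_preimage_equiv]
  congr 1
  ext y
  simp [box]

theorem volume_unitCube (d : ℕ) : volume (unitCube d) = 1 := by
  simpa [unitCube] using volume_setOf_Icc (d := d) (fun _ => 0) (fun _ => 1)

theorem isClosed_unitCube (d : ℕ) : IsClosed (unitCube d) := by
  simp only [unitCube, Set.ofPred_forall, Set.ofPred_and]
  exact isClosed_iInter fun k => (isClosed_le (by fun_prop) (by fun_prop)).inter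
    (isClosed_le (by fun_prop) (by fun_prop))

theorem isCompact_unitCube (d : ℕ) : IsCompact (unitCube d) := by
  refine isCompact_of_isClosed_isBounded (isClosed_unitCube d) ?_
  refine (isBounded_iff_subset_closedBall 0).2 ⟨√d, fun x hx => ?_⟩
  rw [mem_closedBall_zero_iff, EuclideanSpace.norm_eq]
  refine Real.sqrt_le_sqrt ?_
  calc ∑ k, ‖x k‖ ^ 2 ≤ ∑ _k : Fin d, (1 : ℝ) := Finset.sum_le_sum fun k _ => by
        rw [Real.norm_of_nonneg (hx k).1]
        exact pow_le_one₀ (hx k).1 (hx k).2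
    _ = d := by simp

theorem measurableSet_unitCube (d : ℕ) : MeasurableSet (unitCube d) :=
  (isClosed_unitCube d).measurableSet

/-- The pieces of an equivolume partition have volume `1 / N`. -/
theorem volume_eq_inv {Ω : Fin N → Set (E d)} (h : IsPartition Ω) (he : IsEquivolume Ω)
    (i : Fin N) : volume (Ω i) = (N : ENNReal)⁻¹ := by
  have h1 : volume (unitCube d) = ∑ j, volume (Ω j) := by
    rw [← h.cover, measure_iUnion₀ (fun i j hij => h.overlap i j hij) h.measurable, tsum_fintype]
  rw [volume_unitCube, Finset.sum_congr rfl fun j _ => he j i] at h1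
  simp only [Finset.sum_const, Finset.card_univ, Fintype.card_fin, nsmul_eq_mul] at h1
  exact ENNReal.eq_inv_of_mul_eq_one_left (by rw [mul_comm]; exact h1.symm)

theorem isProbabilityMeasure_sampleLaw {Ω : Fin N → Set (E d)} (h : IsPartition Ω)
    (he : IsEquivolume Ω) : IsProbabilityMeasure (sampleLaw Ω) := by
  have : ∀ i, IsProbabilityMeasure (ProbabilityTheory.cond volume (Ω i)) := fun i => by
    have hv := volume_eq_inv h he i
    have : N ≠ 0 := fun h0 => (h0 ▸ i).elim0
    refine ProbabilityTheory.cond_isProbabilityMeasure_of_finite ?_ ?_ <;> rw [hv] <;> simp [this]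
  unfold sampleLaw
  infer_instance

/-- The density constant is the same for all equivolume partitions, so only the domain of
integration depends on `Ω`. -/
theorem sampleLaw_eq_smul_restrict {Ω : Fin N → Set (E d)} (h : IsPartition Ω)
    (he : IsEquivolume Ω) :
    sampleLaw Ω = (N : ENNReal) ^ N • volume.restrict (Set.univ.pi Ω) := by
  have hfin : ∀ i, IsFiniteMeasure (volume.restrict (Ω i)) := fun i => by
    have hv := volume_eq_inv h he i
    have : N ≠ 0 := fun h0 => (h0 ▸ i).elim0
    exact ⟨by rw [Measure.restrict_apply_univ, hv]; simp [this, Nat.pos_iff_ne_zero]⟩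
  have hsf : ∀ i, SigmaFinite (ProbabilityTheory.cond volume (Ω i)) := fun i => inferInstance
  unfold sampleLaw
  refine Measure.pi_eq fun s hs => ?_
  rw [Measure.smul_apply, volume_pi, Measure.restrict_pi_pi, Measure.pi_pi, smul_eq_mul]
  simp only [ProbabilityTheory.cond, Measure.smul_apply, smul_eq_mul, volume_eq_inv h he, inv_inv,
    Finset.prod_mul_distrib, Finset.prod_const, Finset.card_univ, Fintype.card_fin]

/-! ### Measurability and boundedness of the discrepancies -/

theorem measurableSet_mem_box : MeasurableSet {q : E d × E d | q.1 ∈ box q.2} := by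
  have : {q : E d × E d | q.1 ∈ box q.2} =
      ⋂ k, {q : E d × E d | 0 ≤ q.1 k} ∩ {q | q.1 k < q.2 k} := by
    ext q
    simp [box]
  rw [this]
  exact MeasurableSet.iInter fun k =>
    (measurableSet_le (by fun_prop) (by fun_prop)).inter
      (measurableSet_lt (by fun_prop) (by fun_prop))

theorem countBox_eq_sum (P : Fin N → E d) (x : E d) :
    (countBox P x : ℝ) = ∑ i, {q : E d × E d | q.1 ∈ box q.2}.indicator 1 (P i, x) := by
  classical
  simp only [countBox, Set.ncard_eq_toFinset_card', Set.indicator_apply, Finset.sum_ite,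
    Set.mem_ofPred_eq]
  simp

theorem measurable_discFun :
    Measurable fun q : (Fin N → E d) × E d => discFun q.1 q.2 := by
  unfold discFun
  simp only [countBox_eq_sum]
  refine Measurable.sub (Measurable.div_const (Finset.measurable_sum _ fun i _ => ?_) _) ?_
  · have : Measurable fun q : (Fin N → E d) × E d => (q.1 i, q.2) := by fun_prop
    exact (measurable_one.indicator measurableSet_mem_box).comp this
  · simp only [measureReal_def, volume_box]
    fun_prop

theorem volume_real_box {x : E d} (hx : x ∈ unitCube d) : volume.real (box x) = ∏ k, x k := by
  rw [measureReal_def, volume_box, ENNReal.toReal_prod]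
  exact Finset.prod_congr rfl fun k _ => ENNReal.toReal_ofReal (hx k).1

theorem abs_discFun_le_one (P : Fin N → E d) {x : E d} (hx : x ∈ unitCube d) :
    |discFun P x| ≤ 1 := by
  have h1 : volume.real (box x) ≤ 1 := by
    rw [volume_real_box hx]
    exact Finset.prod_le_one (fun k _ => (hx k).1) fun k _ => (hx k).2
  have h2 : (countBox P x : ℝ) ≤ N := by
    have h := Set.ncard_le_card {i | P i ∈ box x}
    simpa [countBox] using h
  have h3 : (countBox P x : ℝ) / N ≤ 1 := div_le_one_of_le₀ h2 (Nat.cast_nonneg _)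
  have h4 : 0 ≤ (countBox P x : ℝ) / N := by positivity
  have h5 : 0 ≤ volume.real (box x) := measureReal_nonneg
  rw [discFun, abs_le]
  constructor <;> linarith

theorem lpDisc_rpow {p : ℝ} (hp : 1 ≤ p) (P : Fin N → E d) :
    lpDisc p P ^ p = ∫ x in unitCube d, |discFun P x| ^ p := by
  rw [lpDisc, ← Real.rpow_mul (integral_nonneg fun x => by positivity),
    one_div_mul_cancel (by positivity), Real.rpow_one]

theorem measurable_lpDisc_rpow {p : ℝ} (hp : 1 ≤ p) :
    Measurable fun P : Fin N → E d => lpDisc p P ^ p := by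
  simp only [lpDisc_rpow hp]
  have h : Measurable fun q : (Fin N → E d) × E d => |discFun q.1 q.2| ^ p :=
    (measurable_discFun.abs).pow_const p
  exact (h.stronglyMeasurable.integral_prod_right').measurable

theorem abs_lpDisc_rpow_le_one {p : ℝ} (hp : 1 ≤ p) (P : Fin N → E d) :
    |lpDisc p P ^ p| ≤ 1 := by
  rw [lpDisc_rpow hp, ← Real.norm_eq_abs]
  have h := norm_setIntegral_le_of_norm_le_const (μ := volume) (s := unitCube d) (C := 1)
    (f := fun x => |discFun P x| ^ p) (by simp [volume_unitCube]) fun x hx => by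
      rw [Real.norm_of_nonneg (by positivity)]
      exact Real.rpow_le_one (abs_nonneg _) (abs_discFun_le_one P hx) (by positivity)
  simpa [measureReal_def, volume_unitCube] using h

/-- The points of the unit cube with coordinates in `{0, 1/(m+1), 2/(m+1), …}`. -/
def gridPoint (m : ℕ) (j : Fin d → ℕ) : E d :=
  WithLp.toLp 2 fun k => min 1 ((j k : ℝ) / (m + 1))

theorem gridPoint_mem_unitCube (m : ℕ) (j : Fin d → ℕ) : gridPoint m j ∈ unitCube d :=
  fun k => ⟨le_min zero_le_one (by positivity), min_le_left _ _⟩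

/-- The largest grid point that is strictly below `x` in every non-zero coordinate. -/
def gridBelow (m : ℕ) (x : E d) : E d := gridPoint m fun k => ⌈((m : ℝ) + 1) * x k⌉₊ - 1

theorem gridBelow_apply_le {x : E d} (hx : x ∈ unitCube d) (m : ℕ) (k : Fin d) :
    gridBelow m x k ≤ x k := by
  refine (min_le_right _ _).trans ?_
  have hm : (0 : ℝ) < m + 1 := by positivity
  rw [div_le_iff₀ hm]
  -- The truncated subtraction in `gridBelow` gives `0` when the ceiling is `0`, that is, when `x k
  -- = 0`.
  rcases Nat.eq_zero_or_pos ⌈((m : ℝ) + 1) * x k⌉₊ with h | h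
  · simpa [h] using mul_nonneg (hx k).1 hm.le
  · have := Nat.ceil_lt_add_one (mul_nonneg hm.le (hx k).1)
    push_cast [Nat.cast_sub (Nat.succ_le_of_lt h)]
    linarith

theorem tendsto_gridBelow_apply {x : E d} (hx : x ∈ unitCube d) (k : Fin d) :
    Tendsto (fun m => gridBelow m x k) atTop (𝓝 (x k)) := by
  have hlow : Tendsto (fun m : ℕ => x k - 1 / ((m : ℝ) + 1)) atTop (𝓝 (x k)) := by
    simpa using tendsto_const_nhds.sub (tendsto_one_div_add_atTop_nhds_zero_nat (𝕜 := ℝ))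
  refine tendsto_of_tendsto_of_tendsto_of_le_of_le hlow tendsto_const_nhds (fun m => ?_)
    fun m => gridBelow_apply_le hx m k
  have hm : (0 : ℝ) < m + 1 := by positivity
  refine le_min ?_ ?_
  · have : 0 < 1 / ((m : ℝ) + 1) := by positivity
    linarith [(hx k).2]
  · rw [le_div_iff₀ hm, sub_mul, one_div_mul_cancel hm.ne']
    have h1 := Nat.le_ceil (((m : ℝ) + 1) * x k)
    have h2 : (⌈((m : ℝ) + 1) * x k⌉₊ : ℝ) ≤ ((⌈((m : ℝ) + 1) * x k⌉₊ - 1 : ℕ) : ℝ) + 1 := by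
      exact_mod_cast (by omega :
        ⌈((m : ℝ) + 1) * x k⌉₊ ≤ ⌈((m : ℝ) + 1) * x k⌉₊ - 1 + 1)
    linarith

/-- Boxes are half-open, so a sample point in `box x` is strictly below `x` and stays in the box
once the grid point is close enough. Approximation from below never adds a sample point. Hence the
count is eventually constant, and the volume is continuous. -/
theorem tendsto_discFun_gridBelow (P : Fin N → E d) {x : E d} (hx : x ∈ unitCube d) :
    Tendsto (fun m => discFun P (gridBelow m x)) atTop (𝓝 (discFun P x)) := by
  have hmem : ∀ i, ∀ᶠ m in atTop, (P i ∈ box (gridBelow m x) ↔ P i ∈ box x) := by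
    intro i
    by_cases hi : P i ∈ box x
    · have : ∀ᶠ m in atTop, ∀ k, P i k < gridBelow m x k :=
        eventually_all.2 fun k => (tendsto_gridBelow_apply hx k).eventually_const_lt (hi k).2
      filter_upwards [this] with m hm
      exact iff_of_true (fun k => ⟨(hi k).1, hm k⟩) hi
    · refine Eventually.of_forall fun m => iff_of_false (fun h => hi fun k => ?_) hi
      exact ⟨(h k).1, (h k).2.trans_le (gridBelow_apply_le hx m k)⟩
  have hcount : ∀ᶠ m in atTop, (countBox P (gridBelow m x) : ℝ) / N = countBox P x / N := by
    filter_upwards [eventually_all.2 hmem] with m hm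
    simp only [countBox, hm]
  refine Tendsto.sub (tendsto_const_nhds.congr' (hcount.mono fun _ h => h.symm)) ?_
  simp only [volume_real_box hx, volume_real_box (gridPoint_mem_unitCube _ _), gridBelow]
  exact tendsto_finsetProd _ fun k _ => tendsto_gridBelow_apply hx k

theorem unitCube_nonempty (d : ℕ) : (unitCube d).Nonempty :=
  ⟨0, fun k => by simp⟩

theorem bddAbove_range_abs_discFun {ι : Type*} (P : Fin N → E d) {f : ι → E d}
    (hf : ∀ i, f i ∈ unitCube d) : BddAbove (Set.range fun i => |discFun P (f i)|) :=
  ⟨1, by rintro _ ⟨i, rfl⟩; exact abs_discFun_le_one P (hf i)⟩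

/-- The star discrepancy is a supremum over countably many anchored boxes. -/
theorem starDisc_eq_iSup_gridPoint (P : Fin N → E d) :
    starDisc P = ⨆ q : ℕ × (Fin d → ℕ), |discFun P (gridPoint q.1 q.2)| := by
  have : Nonempty (unitCube d) := (unitCube_nonempty d).to_subtype
  refine le_antisymm (ciSup_le fun x => ?_) (ciSup_le fun q => ?_)
  · refine le_of_tendsto' (tendsto_discFun_gridBelow P x.2).abs fun m => ?_
    exact le_ciSup (f := fun q : ℕ × (Fin d → ℕ) => |discFun P (gridPoint q.1 q.2)|)
      (bddAbove_range_abs_discFun P fun q => gridPoint_mem_unitCube _ _) (m, _)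
  · exact le_ciSup (f := fun x : unitCube d => |discFun P (x : E d)|)
      (bddAbove_range_abs_discFun P fun x => x.2) ⟨_, gridPoint_mem_unitCube q.1 q.2⟩

theorem measurable_discFun_left (x : E d) : Measurable fun P : Fin N → E d => discFun P x :=
  Measurable.of_uncurry_right (f := fun (P : Fin N → E d) (x : E d) => discFun P x)
    measurable_discFun

theorem measurable_starDisc : Measurable fun P : Fin N → E d => starDisc P := by
  simp only [starDisc_eq_iSup_gridPoint]
  exact Measurable.iSup fun q => (measurable_discFun_left _).abs

theorem abs_starDisc_le_one (P : Fin N → E d) : |starDisc P| ≤ 1 := by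
  have : Nonempty (unitCube d) := (unitCube_nonempty d).to_subtype
  rw [starDisc, abs_of_nonneg (Real.iSup_nonneg fun x => abs_nonneg _)]
  exact ciSup_le fun x => abs_discFun_le_one P x.2

/-! ### A convex equivolume partition: parallel slabs -/

/-- The `i`-th of `N` slabs of equal thickness orthogonal to the direction `k₀`. -/
def slab (N : ℕ) (k₀ : Fin d) (i : Fin N) : Set (E d) :=
  {x | ∀ k, Function.update (0 : Fin d → ℝ) k₀ ((i : ℝ) / N) k ≤ x k ∧
    x k ≤ Function.update (1 : Fin d → ℝ) k₀ (((i : ℝ) + 1) / N) k}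

theorem mem_slab_iff {k₀ : Fin d} {i : Fin N} {x : E d} :
    x ∈ slab N k₀ i ↔ x ∈ unitCube d ∧ (i : ℝ) / N ≤ x k₀ ∧ x k₀ ≤ ((i : ℝ) + 1) / N := by
  have hN : (0 : ℝ) < N := by exact_mod_cast i.pos
  have h1 : ((i : ℝ) + 1) / N ≤ 1 := (div_le_one hN).2 (by exact_mod_cast i.2)
  have h0 : 0 ≤ (i : ℝ) / N := by positivity
  constructor
  · intro h
    have hk := h k₀
    simp only [Function.update_self] at hk
    refine ⟨fun k => ?_, hk⟩
    rcases eq_or_ne k k₀ with rfl | hne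
    · exact ⟨h0.trans hk.1, hk.2.trans h1⟩
    · simpa [Function.update_of_ne hne] using h k
  · rintro ⟨hx, hk⟩ k
    rcases eq_or_ne k k₀ with rfl | hne
    · simpa using hk
    · simpa [Function.update_of_ne hne] using hx k

theorem isClosed_slab (k₀ : Fin d) (i : Fin N) : IsClosed (slab N k₀ i) := by
  simp only [slab, Set.ofPred_forall, Set.ofPred_and]
  exact isClosed_iInter fun k => (isClosed_le (by fun_prop) (by fun_prop)).inter
    (isClosed_le (by fun_prop) (by fun_prop))

theorem isCompact_slab (k₀ : Fin d) (i : Fin N) : IsCompact (slab N k₀ i) :=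
  (isCompact_unitCube d).of_isClosed_subset (isClosed_slab k₀ i) fun _ hx => (mem_slab_iff.1 hx).1

theorem convex_slab (k₀ : Fin d) (i : Fin N) : Convex ℝ (slab N k₀ i) := by
  intro x hx y hy a b ha hb hab k
  exact (convex_Icc _ _) (hx k) (hy k) ha hb hab

theorem volume_slab (k₀ : Fin d) (i : Fin N) :
    volume (slab N k₀ i) = ∏ k, ENNReal.ofReal (Function.update (1 : Fin d → ℝ) k₀ (1 / N) k) := by
  rw [slab, volume_setOf_Icc]
  refine Finset.prod_congr rfl fun k _ => ?_
  rcases eq_or_ne k k₀ with rfl | hne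
  · simp only [Function.update_self]
    congr 1
    ring
  · simp [Function.update_of_ne hne]

theorem volume_slab_inter_slab_of_lt (k₀ : Fin d) {i j : Fin N} (hij : i < j) :
    volume (slab N k₀ i ∩ slab N k₀ j) = 0 := by
  -- For `i < j` the two slabs can meet only in the hyperplane `x k₀ = t`, so their intersection
  -- lies in a box of zero thickness.
  set t : ℝ := ((i : ℝ) + 1) / N
  have hsub : slab N k₀ i ∩ slab N k₀ j ⊆ {x | ∀ k, Function.update (0 : Fin d → ℝ) k₀ t k ≤ x k ∧
      x k ≤ Function.update (1 : Fin d → ℝ) k₀ t k} := by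
    rintro x ⟨hi, hj⟩ k
    rw [mem_slab_iff] at hi hj
    rcases eq_or_ne k k₀ with rfl | hne
    · simp only [Function.update_self]
      refine ⟨le_trans ?_ hj.2.1, hi.2.2⟩
      refine div_le_div_of_nonneg_right ?_ (Nat.cast_nonneg _)
      exact_mod_cast hij
    · simpa [Function.update_of_ne hne] using hi.1 k
  refine measure_mono_null hsub ?_
  rw [volume_setOf_Icc]
  exact Finset.prod_eq_zero (Finset.mem_univ k₀) (by simp)

theorem iUnion_slab (hN : 1 ≤ N) (k₀ : Fin d) : ⋃ i, slab N k₀ i = unitCube d := by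
  refine Set.Subset.antisymm (Set.iUnion_subset fun i x hx => (mem_slab_iff.1 hx).1) fun x hx => ?_
  have hN' : (0 : ℝ) < N := by exact_mod_cast hN
  have hx0 := hx k₀
  rw [Set.mem_iUnion]
  -- On the last face the floor used below would be `N`, which is out of range.
  by_cases h1 : x k₀ = 1
  · refine ⟨⟨N - 1, by omega⟩, mem_slab_iff.2 ⟨hx, ?_⟩⟩
    simp only [Nat.cast_sub hN, h1, Nat.cast_one, sub_add_cancel, div_self hN'.ne', le_refl,
      and_true]
    rw [div_le_one hN']
    linarith
  · have hlt : x k₀ < 1 := lt_of_le_of_ne hx0.2 h1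
    have hfl : ⌊x k₀ * N⌋₊ < N := by
      rw [Nat.floor_lt (by nlinarith)]
      nlinarith
    refine ⟨⟨⌊x k₀ * N⌋₊, hfl⟩, mem_slab_iff.2 ⟨hx, ?_, ?_⟩⟩
    · rw [div_le_iff₀ hN']
      exact Nat.floor_le (by nlinarith)
    · rw [le_div_iff₀ hN']
      exact (Nat.lt_floor_add_one _).le

theorem slab_nonempty (k₀ : Fin d) (i : Fin N) : (slab N k₀ i).Nonempty := by
  have hN : (0 : ℝ) < N := by exact_mod_cast i.pos
  refine nonempty_of_measure_ne_zero (μ := volume) ?_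
  rw [volume_slab]
  refine Finset.prod_ne_zero_iff.2 fun k _ => (ENNReal.ofReal_pos.2 ?_).ne'
  rcases eq_or_ne k k₀ with rfl | hne
  · simpa using hN
  · simp [Function.update_of_ne hne]

theorem slab_mem_convexPartitions (hN : 1 ≤ N) (k₀ : Fin d) :
    slab N k₀ ∈ convexPartitions d N := by
  refine ⟨⟨fun i => (isClosed_slab k₀ i).measurableSet.nullMeasurableSet, iUnion_slab hN k₀,
    fun i j hij => ?_⟩, fun i j => by rw [volume_slab, volume_slab],
    fun i => ⟨slab_nonempty k₀ i, isCompact_slab k₀ i, convex_slab k₀ i⟩⟩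
  rcases hij.lt_or_gt with h | h
  · exact volume_slab_inter_slab_of_lt k₀ h
  · rw [Set.inter_comm]
    exact volume_slab_inter_slab_of_lt k₀ h

/-! ### Compactness, continuity and existence of minimizers -/

/-- Equivolume partitions of the unit cube into non-empty compact sets with the property `Q`. -/
def compactPartitions (d N : ℕ) (Q : Set (E d) → Prop) : Set (Fin N → Set (E d)) :=
  {Ω | IsPartition Ω ∧ IsEquivolume Ω ∧ ∀ i, (Ω i).Nonempty ∧ IsCompact (Ω i) ∧ Q (Ω i)}

theorem ae_volume_pi_eventually_mem_iff {r : ℝ} (hr : 0 < r)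
    {K : ℕ → Fin N → NonemptyCompacts (E d)} {L : Fin N → NonemptyCompacts (E d)}
    (hK : ∀ i, Tendsto (fun n => K n i) atTop (𝓝 (L i)))
    (hreach : ∀ n i, ReachAtLeast r (K n i : Set (E d))) :
    ∀ᵐ P : Fin N → E d, ∀ᶠ n in atTop, ∀ i,
      (P i ∈ (K n i : Set (E d)) ↔ P i ∈ (L i : Set (E d))) := by
  have h : ∀ᵐ P : Fin N → E d, ∀ i, ∀ᶠ n in atTop,
      (P i ∈ (K n i : Set (E d)) ↔ P i ∈ (L i : Set (E d))) :=
    ae_all_iff.2 fun i => (Measure.quasiMeasurePreserving_eval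
      (fun _ : Fin N => (volume : Measure (E d))) i).ae
      (p := fun x => ∀ᶠ n in atTop, (x ∈ (K n i : Set (E d)) ↔ x ∈ (L i : Set (E d))))
      (ae_eventually_mem_iff_of_tendsto hr (hK i) fun n => hreach n i)
  filter_upwards [h] with P hP using eventually_all.2 hP

theorem subset_of_tendsto {K : ℕ → NonemptyCompacts (E d)} {L : NonemptyCompacts (E d)}
    (hK : Tendsto K atTop (𝓝 L)) {A : Set (E d)} (hA : IsClosed A)
    (hsub : ∀ n, (K n : Set (E d)) ⊆ A) : (L : Set (E d)) ⊆ A := by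
  intro x hx
  have hne : A.Nonempty := (K 0).nonempty.mono (hsub 0)
  rw [hA.mem_iff_infDist_zero hne]
  refine le_antisymm ?_ infDist_nonneg
  rw [← (mem_iff_infDist_eq_zero L x).1 hx]
  exact ge_of_tendsto' (tendsto_infDist_nonemptyCompacts hK tendsto_const_nhds)
    fun n => infDist_le_infDist_of_subset (hsub n) (K n).nonempty

/-- Fatou's lemma for indicators; it makes the overlaps of the limit pieces null. -/
theorem measure_le_of_ae_eventually_mem {α : Type*} [MeasurableSpace α] {μ : Measure α}
    {s : ℕ → Set α} {t : Set α} {c : ENNReal} (hs : ∀ n, MeasurableSet (s n))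
    (ht : MeasurableSet t) (h : ∀ᵐ x ∂μ, x ∈ t → ∀ᶠ n in atTop, x ∈ s n)
    (hc : ∀ n, μ (s n) ≤ c) : μ t ≤ c := by
  calc μ t = ∫⁻ x, t.indicator 1 x ∂μ := (lintegral_indicator_one ht).symm
    _ ≤ ∫⁻ x, liminf (fun n => (s n).indicator 1 x) atTop ∂μ := by
        refine lintegral_mono_ae ?_
        filter_upwards [h] with x hx
        by_cases hxt : x ∈ t
        · refine le_liminf_of_le (by isBoundedDefault) ?_
          filter_upwards [hx hxt] with n hn
          simp [hxt, hn]
        · simp [hxt]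
    _ ≤ liminf (fun n => ∫⁻ x, (s n).indicator 1 x ∂μ) atTop :=
        lintegral_liminf_le fun n => measurable_one.indicator (hs n)
    _ ≤ c := by
        simp only [lintegral_indicator_one (hs _)]
        exact (liminf_le_liminf (Eventually.of_forall hc)).trans (by simp)

/-- Covering needs only convergence of distances: a point outside all of the finitely many limit
pieces would eventually be outside all approximating pieces. Null overlaps and equal volumes rest on
almost everywhere convergence of the indicators, with the cube as common bound. -/
theorem mem_compactPartitions_of_tendsto {r : ℝ} (hr : 0 < r) {Q : Set (E d) → Prop}
    (hQ : ∀ K : NonemptyCompacts (E d), Q K → ReachAtLeast r (K : Set (E d)))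
    (hQlim : ∀ (K : ℕ → NonemptyCompacts (E d)) (L : NonemptyCompacts (E d)),
      Tendsto K atTop (𝓝 L) → (∀ n, Q (K n)) → Q L)
    {K : ℕ → Fin N → NonemptyCompacts (E d)} {L : Fin N → NonemptyCompacts (E d)}
    (hK : ∀ i, Tendsto (fun n => K n i) atTop (𝓝 (L i)))
    (hmem : ∀ n, (fun i => (K n i : Set (E d))) ∈ compactPartitions d N Q) :
    (fun i => (L i : Set (E d))) ∈ compactPartitions d N Q := by
  have hae : ∀ i, ∀ᵐ x : E d, ∀ᶠ n in atTop, (x ∈ (K n i : Set (E d)) ↔ x ∈ (L i : Set (E d))) :=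
    fun i => ae_eventually_mem_iff_of_tendsto hr (hK i) fun n => hQ _ ((hmem n).2.2 i).2.2
  have hmeasK : ∀ n i, MeasurableSet (K n i : Set (E d)) := fun n i => (K n i).isCompact.measurableSet
  have hmeasL : ∀ i, MeasurableSet (L i : Set (E d)) := fun i => (L i).isCompact.measurableSet
  have hcover : ⋃ i, (L i : Set (E d)) = unitCube d := by
    refine Set.Subset.antisymm (Set.iUnion_subset fun i => ?_) fun x hx => ?_
    · refine subset_of_tendsto (hK i) (isClosed_unitCube d) fun n => ?_
      rw [← (hmem n).1.cover]
      exact Set.subset_iUnion (fun i => (K n i : Set (E d))) i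
    · by_contra hcon
      simp only [Set.mem_iUnion, not_exists] at hcon
      have hev : ∀ᶠ n in atTop, ∀ i, 0 < infDist x (K n i) := eventually_all.2 fun i =>
        (tendsto_infDist_nonemptyCompacts (hK i) tendsto_const_nhds).eventually_const_lt
          ((notMem_iff_infDist_pos (L i) x).1 (hcon i))
      obtain ⟨n, hn⟩ := hev.exists
      rw [← (hmem n).1.cover, Set.mem_iUnion] at hx
      obtain ⟨i, hi⟩ := hx
      exact (notMem_iff_infDist_pos _ _).2 (hn i) hi
  have hoverlap : ∀ i j, i ≠ j → volume ((L i : Set (E d)) ∩ L j) = 0 := by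
    intro i j hij
    refine le_antisymm ?_ zero_le
    refine measure_le_of_ae_eventually_mem (fun n => (hmeasK n i).inter (hmeasK n j))
      ((hmeasL i).inter (hmeasL j)) ?_ fun n => ((hmem n).1.overlap i j hij).le
    filter_upwards [hae i, hae j] with x hi hj hx
    filter_upwards [hi, hj] with n hni hnj using ⟨hni.2 hx.1, hnj.2 hx.2⟩
  have hvol : ∀ i, volume (L i : Set (E d)) = (N : ENNReal)⁻¹ := by
    intro i
    have hlim : Tendsto (fun n => volume (K n i : Set (E d))) atTop
        (𝓝 (volume (L i : Set (E d)))) := by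
      have hsub : ∀ n, (K n i : Set (E d)) ⊆ unitCube d := fun n => by
        rw [← (hmem n).1.cover]
        exact Set.subset_iUnion (fun i => (K n i : Set (E d))) i
      refine tendsto_measure_of_ae_tendsto_indicator atTop (hmeasL i) (hmeasK · i)
        (measurableSet_unitCube d) (by simp [volume_unitCube]) (Eventually.of_forall hsub) (hae i)
    refine tendsto_nhds_unique hlim ?_
    simp only [volume_eq_inv (hmem _).1 (hmem _).2.1]
    exact tendsto_const_nhds
  exact ⟨⟨fun i => (hmeasL i).nullMeasurableSet, hcover, hoverlap⟩,
    fun i j => (hvol i).trans (hvol j).symm,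
    fun i => ⟨(L i).nonempty, (L i).isCompact,
      hQlim _ _ (hK i) fun n => ((hmem n).2.2 i).2.2⟩⟩

theorem integral_sampleLaw {Ω : Fin N → Set (E d)} (h : IsPartition Ω) (he : IsEquivolume Ω)
    (hm : ∀ i, MeasurableSet (Ω i)) (φ : (Fin N → E d) → ℝ) :
    ∫ P, φ P ∂(sampleLaw Ω) = ((N : ENNReal) ^ N).toReal * ∫ P, (Set.univ.pi Ω).indicator φ P := by
  rw [sampleLaw_eq_smul_restrict h he, integral_smul_measure, smul_eq_mul,
    integral_indicator (MeasurableSet.univ_pi hm)]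

/-- Dominated convergence on the product space: almost every fixed `P` eventually lies in the
approximating product exactly when it lies in the limit product. Only the domain moves, so `φ` may
be discontinuous. -/
theorem tendsto_integral_sampleLaw {r : ℝ} (hr : 0 < r)
    {K : ℕ → Fin N → NonemptyCompacts (E d)} {L : Fin N → NonemptyCompacts (E d)}
    (hK : ∀ i, Tendsto (fun n => K n i) atTop (𝓝 (L i)))
    (hmem : ∀ n, (fun i => (K n i : Set (E d))) ∈ reachPartitions d N r)
    (hmemL : (fun i => (L i : Set (E d))) ∈ reachPartitions d N r)
    {φ : (Fin N → E d) → ℝ} (hφ : Measurable φ) (hφ1 : ∀ P, |φ P| ≤ 1) :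
    Tendsto (fun n => ∫ P, φ P ∂(sampleLaw fun i => (K n i : Set (E d)))) atTop
      (𝓝 (∫ P, φ P ∂(sampleLaw fun i => (L i : Set (E d))))) := by
  have hmeas : ∀ M : Fin N → NonemptyCompacts (E d), ∀ i, MeasurableSet (M i : Set (E d)) :=
    fun M i => (M i).isCompact.measurableSet
  simp only [integral_sampleLaw (hmem _).1 (hmem _).2.1 (hmeas _),
    integral_sampleLaw hmemL.1 hmemL.2.1 (hmeas _)]
  refine Tendsto.const_mul _ ?_
  have hcube : MeasurableSet (Set.univ.pi fun _ : Fin N => unitCube d) :=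
    MeasurableSet.univ_pi fun _ => measurableSet_unitCube d
  refine tendsto_integral_of_dominated_convergence
    ((Set.univ.pi fun _ : Fin N => unitCube d).indicator 1)
    (fun n => (hφ.indicator (MeasurableSet.univ_pi (hmeas (K n)))).aestronglyMeasurable) ?_ ?_ ?_
  · rw [integrable_indicator_iff hcube]
    refine integrableOn_const (C := (1 : ℝ)) ?_
    rw [volume_pi_pi]
    simp [volume_unitCube]
  · refine fun n => Eventually.of_forall fun P => ?_
    by_cases hP : P ∈ Set.univ.pi fun i => (K n i : Set (E d))
    · have hP' : P ∈ Set.univ.pi fun _ : Fin N => unitCube d := fun i _ => by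
        rw [← (hmem n).1.cover]
        exact Set.mem_iUnion.2 ⟨i, hP i trivial⟩
      rw [Set.indicator_of_mem hP, Set.indicator_of_mem hP']
      exact hφ1 P
    · rw [Set.indicator_of_notMem hP, norm_zero]
      exact Set.indicator_nonneg (fun _ _ => zero_le_one) P
  · filter_upwards [ae_volume_pi_eventually_mem_iff hr hK fun n i => ((hmem n).2.2 i).2.2] with P hP
    refine tendsto_const_nhds.congr' ?_
    filter_upwards [hP] with n hn
    have : P ∈ Set.univ.pi (fun i => (K n i : Set (E d))) ↔
        P ∈ Set.univ.pi (fun i => (L i : Set (E d))) := by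
      simp only [Set.mem_univ_pi, hn]
    by_cases h : P ∈ Set.univ.pi (fun i => (L i : Set (E d)))
    · rw [Set.indicator_of_mem h, Set.indicator_of_mem (this.2 h)]
    · rw [Set.indicator_of_notMem h, Set.indicator_of_notMem (mt this.1 h)]

/-- The value at the limit of a convergent subsequence of a minimizing sequence is the infimum. -/
theorem exists_forall_le_of_isSeqCompact {X : Type*} [TopologicalSpace X] {S : Set X}
    (hS : IsSeqCompact S) (hne : S.Nonempty) {F : X → ℝ} (hb : BddBelow (F '' S))
    (hF : ∀ (u : ℕ → X) (a : X), (∀ n, u n ∈ S) → a ∈ S → Tendsto u atTop (𝓝 a) →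
      Tendsto (fun n => F (u n)) atTop (𝓝 (F a))) :
    ∃ a ∈ S, ∀ b ∈ S, F a ≤ F b := by
  obtain ⟨v, -, hv, hvS⟩ := exists_seq_tendsto_sInf (hne.image F) hb
  choose u huS hu using hvS
  obtain ⟨a, ha, φ, hφ, hlim⟩ := hS huS
  refine ⟨a, ha, fun b hbS => ?_⟩
  have h1 := hF _ a (fun n => huS (φ n)) ha hlim
  have h2 : Tendsto (fun n => F (u (φ n))) atTop (𝓝 (sInf (F '' S))) := by
    simp only [hu]
    exact hv.comp hφ.tendsto_atTop
  rw [tendsto_nhds_unique h1 h2]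
  exact csInf_le hb ⟨b, hbS, rfl⟩

theorem integrable_of_abs_le_one {α : Type*} [MeasurableSpace α] {μ : Measure α}
    [IsFiniteMeasure μ] {φ : α → ℝ} (hφ : Measurable φ) (hφ1 : ∀ P, |φ P| ≤ 1) :
    Integrable φ μ :=
  Integrable.of_bound hφ.aestronglyMeasurable 1 (Eventually.of_forall hφ1)

/-- Blaschke selection for the subsets of the cube gives a convergent subsequence in each of the `N`
factors; closedness of the class does the rest. -/
theorem isSeqCompact_compactPartitions {r : ℝ} (hr : 0 < r) {Q : Set (E d) → Prop}
    (hQ : ∀ K : NonemptyCompacts (E d), Q K → ReachAtLeast r (K : Set (E d)))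
    (hQlim : ∀ (K : ℕ → NonemptyCompacts (E d)) (L : NonemptyCompacts (E d)),
      Tendsto K atTop (𝓝 L) → (∀ n, Q (K n)) → Q L) :
    IsSeqCompact {K : Fin N → NonemptyCompacts (E d) |
      (fun i => (K i : Set (E d))) ∈ compactPartitions d N Q} := by
  intro K hK
  have hcpt : IsCompact (Set.univ.pi fun _ : Fin N =>
      {M : NonemptyCompacts (E d) | (M : Set (E d)) ⊆ unitCube d}) :=
    isCompact_univ_pi fun _ =>
      NonemptyCompacts.isCompact_subsets_of_isCompact (isCompact_unitCube d)
  obtain ⟨L, -, φ, hφ, hlim⟩ := hcpt.tendsto_subseq (x := K) fun n i _ => by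
    change (K n i : Set (E d)) ⊆ unitCube d
    rw [← (hK n).1.cover]
    exact Set.subset_iUnion (fun i => (K n i : Set (E d))) i
  exact ⟨L, mem_compactPartitions_of_tendsto hr hQ hQlim (K := K ∘ φ) (tendsto_pi_nhds.1 hlim)
    fun n => hK (φ n), φ, hφ, hlim⟩

/-- The expectation of a bounded measurable function of the stratified sample attains its minimum
over equivolume partitions whose pieces belong to a Hausdorff closed class of sets with reach
bounded from below. -/
theorem exists_minimizer {r : ℝ} (hr : 0 < r) {Q : Set (E d) → Prop}
    (hQ : ∀ K : NonemptyCompacts (E d), Q K → ReachAtLeast r (K : Set (E d)))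
    (hQlim : ∀ (K : ℕ → NonemptyCompacts (E d)) (L : NonemptyCompacts (E d)),
      Tendsto K atTop (𝓝 L) → (∀ n, Q (K n)) → Q L)
    (hne : (compactPartitions d N Q).Nonempty)
    {φ : (Fin N → E d) → ℝ} (hφ : Measurable φ) (hφ1 : ∀ P, |φ P| ≤ 1) :
    ∃ Ω₀ ∈ compactPartitions d N Q, ∀ Ω ∈ compactPartitions d N Q,
      ∫ P, φ P ∂(sampleLaw Ω₀) ≤ ∫ P, φ P ∂(sampleLaw Ω) := by
  -- Lifting to `NonemptyCompacts` supplies the Hausdorff metric.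
  have hlift : ∀ Ω ∈ compactPartitions d N Q, ∃ K : Fin N → NonemptyCompacts (E d),
      Ω = fun i => (K i : Set (E d)) := fun Ω hΩ =>
    ⟨fun i => ⟨⟨Ω i, (hΩ.2.2 i).2.1⟩, (hΩ.2.2 i).1⟩, rfl⟩
  have hreach : ∀ K : Fin N → NonemptyCompacts (E d),
      (fun i => (K i : Set (E d))) ∈ compactPartitions d N Q →
      (fun i => (K i : Set (E d))) ∈ reachPartitions d N r := fun K hK =>
    ⟨hK.1, hK.2.1, fun i => ⟨(hK.2.2 i).1, (hK.2.2 i).2.1, hQ _ (hK.2.2 i).2.2⟩⟩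
  have hne' : {K : Fin N → NonemptyCompacts (E d) |
      (fun i => (K i : Set (E d))) ∈ compactPartitions d N Q}.Nonempty := by
    obtain ⟨Ω, hΩ⟩ := hne
    obtain ⟨K, rfl⟩ := hlift Ω hΩ
    exact ⟨K, hΩ⟩
  have hbdd : BddBelow ((fun K => ∫ P, φ P ∂(sampleLaw fun i => (K i : Set (E d)))) ''
      {K : Fin N → NonemptyCompacts (E d) |
        (fun i => (K i : Set (E d))) ∈ compactPartitions d N Q}) := by
    refine ⟨-1, ?_⟩
    rintro _ ⟨K, hK, rfl⟩
    have := isProbabilityMeasure_sampleLaw hK.1 hK.2.1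
    have h := norm_integral_le_of_norm_le_const (μ := sampleLaw fun i => (K i : Set (E d)))
      (f := φ) (C := 1) (Eventually.of_forall hφ1)
    rw [probReal_univ, mul_one, Real.norm_eq_abs] at h
    exact (abs_le.1 h).1
  obtain ⟨L, hL, hmin⟩ := exists_forall_le_of_isSeqCompact
    (isSeqCompact_compactPartitions hr hQ hQlim) hne' hbdd fun K M hK hM hlim =>
      tendsto_integral_sampleLaw hr (tendsto_pi_nhds.1 hlim) (fun n => hreach _ (hK n))
        (hreach _ hM) hφ hφ1
  refine ⟨_, hL, fun Ω hΩ => ?_⟩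
  obtain ⟨K, rfl⟩ := hlift Ω hΩ
  exact hmin K hΩ

end Stratified

end

/-! ### Existence of optimal partitions -/

open Stratified in
/-- The first conjunct says that the expectations are those of integrable random variables. -/
theorem mainTheorem3 (d N : ℕ) (hd : 1 ≤ d) (hN : 1 ≤ N) (r : ℝ) (hr : 0 < r)
    (p : ℝ) (hp : 1 ≤ p) :
    (∀ Ω : Fin N → Set (Stratified.E d), Stratified.IsPartition Ω → Stratified.IsEquivolume Ω →
      MeasureTheory.IsProbabilityMeasure (Stratified.sampleLaw Ω) ∧
      MeasureTheory.Integrable (fun P => Stratified.lpDisc p P ^ p) (Stratified.sampleLaw Ω) ∧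
      MeasureTheory.Integrable (fun P => Stratified.starDisc P) (Stratified.sampleLaw Ω)) ∧
    (∃ Ωp ∈ Stratified.reachPartitions d N r, ∀ Ω ∈ Stratified.reachPartitions d N r,
      Stratified.meanLp p Ωp ≤ Stratified.meanLp p Ω) ∧
    (∃ Ωs ∈ Stratified.reachPartitions d N r, ∀ Ω ∈ Stratified.reachPartitions d N r,
      Stratified.meanStar Ωs ≤ Stratified.meanStar Ω) ∧
    (∃ Ωp ∈ Stratified.convexPartitions d N, ∀ Ω ∈ Stratified.convexPartitions d N,
      Stratified.meanLp p Ωp ≤ Stratified.meanLp p Ω) ∧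
    (∃ Ωs ∈ Stratified.convexPartitions d N, ∀ Ω ∈ Stratified.convexPartitions d N,
      Stratified.meanStar Ωs ≤ Stratified.meanStar Ω) := by
  have hslab := slab_mem_convexPartitions hN (⟨0, hd⟩ : Fin d)
  have hne_conv : (compactPartitions d N (Convex ℝ)).Nonempty := ⟨_, hslab⟩
  have hne_reach : (compactPartitions d N (ReachAtLeast r)).Nonempty :=
    ⟨_, hslab.1, hslab.2.1, fun i => ⟨(hslab.2.2 i).1, (hslab.2.2 i).2.1,
      reachAtLeast_of_convex (hslab.2.2 i).2.1.isClosed (hslab.2.2 i).1 (hslab.2.2 i).2.2 r⟩⟩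
  -- Convex sets have reach at least every positive number; `1` is an arbitrary choice.
  have hconv : ∀ K : TopologicalSpace.NonemptyCompacts (E d), Convex ℝ (K : Set (E d)) →
      ReachAtLeast 1 (K : Set (E d)) := fun K hK =>
    reachAtLeast_of_convex K.isCompact.isClosed K.nonempty hK 1
  refine ⟨fun Ω h he => ?_, ?_, ?_, ?_, ?_⟩
  · have := isProbabilityMeasure_sampleLaw h he
    exact ⟨this, integrable_of_abs_le_one (measurable_lpDisc_rpow hp) (abs_lpDisc_rpow_le_one hp),
      integrable_of_abs_le_one measurable_starDisc abs_starDisc_le_one⟩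
  -- `reachPartitions` and `convexPartitions` are, by definition, `compactPartitions` with `Q` equal
  -- to `ReachAtLeast r` and `Convex ℝ`.
  · exact exists_minimizer hr (fun _ h => h) (fun _ _ hK h => ReachAtLeast.of_tendsto hK h)
      hne_reach (measurable_lpDisc_rpow hp) (abs_lpDisc_rpow_le_one hp)
  · exact exists_minimizer hr (fun _ h => h) (fun _ _ hK h => ReachAtLeast.of_tendsto hK h)
      hne_reach measurable_starDisc abs_starDisc_le_one
  · exact exists_minimizer one_pos hconv (fun _ _ hK h => convex_of_tendsto hK h)
      hne_conv (measurable_lpDisc_rpow hp) (abs_lpDisc_rpow_le_one hp)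
  · exact exists_minimizer one_pos hconv (fun _ _ hK h => convex_of_tendsto hK h)
      hne_conv measurable_starDisc abs_starDisc_le_one
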